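/- Let $K\ge 2$. For $v=(\mu_{1},\dots,\mu_{K})\in\mathbb{R}^K$ let $\underline{x}^*_v=\{x\in\{1,\dots,K-1\}:\mu_{x}\neq\mu_{x+1}\}$ be its set of change points, and for $N\ge 1$ let $V_{K,N}$ be the set of those $v$ for which $|\underline{x}^*_v|=N$ and any two distinct change points differ by at least $2$. In the environment $v$, playing an action $a_t\in\{1,\dots,K\}$ in round $t=1,2,\dots$ yields a reward $y_t=\mu_{a_t}+\epsilon_t$, where the $\epsilon_t$ are i.i.d. $N(0,1)$ and $\epsilon_t$ is independent of $a_t$ and of everything before round $t$. A policy $\pi$ chooses, after each round $t$ (and before the first), an estimate $\hat x_t\in\{1,\dots,K-1\}$ and then the next action $a_{t+1}$, each by an arbitrary (measurable, possibly randomized) rule based on the past actions, rewards and estimates; let $\mathbb{P}_{\pi,v}$ be the law of the resulting interaction. Let $T_i(t)$ be the number of plays of action $i$ in rounds $1,\dots,t$ and $\hat\mu_i(t)$ the empirical mean of the corresponding rewards. Fix $\delta\in(0,1)$, let $\gamma=2e^3 9^6/\log 3$ and $$\beta(t,\delta)=\log\!\Big(\frac{t\gamma(K-1)}{\delta}\Big)+8\log\log\!\Big(\frac{t\gamma(K-1)}{\delta}\Big),$$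 and let the policy stop at $$\tau_\delta=\min\Big\{t\ge 1:\ \frac{T_{\hat x_t}(t)\,T_{\hat x_t+1}(t)}{2\,(T_{\hat x_t}(t)+T_{\hat x_t+1}(t))}\,\big|\hat\mu_{\hat x_t}(t)-\hat\mu_{\hat x_t+1}(t)\big|^2\ \ge\ \beta(t,\delta)\Big\}$$ (with $\tau_\delta=\infty$ if there is no such $t$; the statistic on the left is read as $0$ if one of the two actions has not been played) and return $\hat x_{\tau_\delta}$. Then for every $N\ge 1$, every $v\in V_{K,N}$ and every policy $\pi$ with this stopping time, $$\mathbb{P}_{\pi,v}\big(\tau_\delta<\infty,\ \hat x_{\tau_\delta}\notin\underline{x}^*_v\big)\le\delta .$$ -/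

import Mathlib

namespace ChangePointBandit

open MeasureTheory ProbabilityTheory

/-! Arms `1, …, K` are represented by `Fin K`, and the possible change points `1, …, K - 1` by
`Fin (K - 1)`: the candidate `x` separates the arm `leftArm x` from the arm `rightArm x`. -/

/-- The arm immediately to the left of the candidate change point `x`. -/
def leftArm {K : ℕ} (x : Fin (K - 1)) : Fin K := ⟨x.1, by omega⟩

/-- The arm immediately to the right of the candidate change point `x`. -/
def rightArm {K : ℕ} (x : Fin (K - 1)) : Fin K := ⟨x.1 + 1, by omega⟩

/-- The set of change points of the vector of mean rewards `v`. -/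
noncomputable def changePoints {K : ℕ} (v : Fin K → ℝ) : Finset (Fin (K - 1)) :=
  Finset.univ.filter fun x => v (leftArm x) ≠ v (rightArm x)

/-- `V_{K,N}`: the environments (given by their mean rewards, the reward of arm `i` having law
`N(v i, 1)`) with `K` arms and exactly `N` change points, any two of which are separated by at
least one action. -/
def Env (K N : ℕ) : Set (Fin K → ℝ) :=
  {v | (changePoints v).card = N ∧
    ∀ x ∈ changePoints v, ∀ x' ∈ changePoints v, x < x' → x.1 + 1 < x'.1}

/-- The record of one step `t = 0, 1, 2, …` of the interaction: the estimate `x̂_t` of a change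
point formed after `t` observations, the action `a_{t+1}` of round `t + 1`, and the reward
`y_{t+1}` of round `t + 1`. -/
abbrev Step (K : ℕ) : Type := Fin (K - 1) × Fin K × ℝ

/-- What is known to the learner after `t` rounds: the actions and rewards of the rounds
`1, …, t`, and its own estimates `x̂_0, …, x̂_{t-1}`. -/
abbrev History (K t : ℕ) : Type := Fin t → Step K

/-- The recommendation rule and the sampling rule of a policy, both possibly randomized: after `t`
rounds the estimate `x̂_t` is drawn given the history, and then the action of round `t + 1`
is drawn given the history and `x̂_t`. Deterministic rules are the Dirac kernels. -/
structure Policy (K : ℕ) where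
  /-- The law of the estimate `x̂_t`. -/
  recommend : (t : ℕ) → Kernel (History K t) (Fin (K - 1))
  /-- The law of the action `a_{t+1}`. -/
  sample : (t : ℕ) → Kernel (History K t × Fin (K - 1)) (Fin K)
  markov_recommend : ∀ t, IsMarkovKernel (recommend t)
  markov_sample : ∀ t, IsMarkovKernel (sample t)

attribute [instance] Policy.markov_recommend Policy.markov_sample

/-- The reward kernel of the environment `v`: arm `i` yields a reward of law `N(v i, 1)`. -/
noncomputable def reward {K : ℕ} (v : Fin K → ℝ) : Kernel (Fin K) ℝ where
  toFun i := gaussianReal (v i) 1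
  measurable' := measurable_of_finite _

instance {K : ℕ} (v : Fin K → ℝ) : IsMarkovKernel (reward v) :=
  ⟨fun i => inferInstanceAs (IsProbabilityMeasure (gaussianReal (v i) 1))⟩

/-- The law of the step `(x̂_t, a_{t+1}, y_{t+1})` given the history of the first `t` rounds. -/
noncomputable def stepKernel {K : ℕ} (π : Policy K) (v : Fin K → ℝ) (t : ℕ) :
    Kernel (History K t) (Step K) :=
  π.recommend t ⊗ₖ (π.sample t ⊗ₖ (reward v).comap Prod.snd measurable_snd)

instance {K : ℕ} (π : Policy K) (v : Fin K → ℝ) (t : ℕ) : IsMarkovKernel (stepKernel π v t) := by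
  unfold stepKernel; infer_instance

/-- Reindexing of the steps `0, …, n` as a history. -/
def toHistory {K : ℕ} (n : ℕ) (h : (i : Finset.Iic n) → (fun _ : ℕ => Step K) i) :
    History K (n + 1) :=
  fun i => h ⟨i.1, Finset.mem_Iic.2 (Nat.lt_succ_iff.1 i.2)⟩

theorem measurable_toHistory {K : ℕ} (n : ℕ) : Measurable (toHistory (K := K) n) :=
  measurable_pi_lambda _ fun _ => measurable_pi_apply _

/-- `ℙ_{π,v}`: the law of the whole interaction between the policy `π` and the environment `v`,
on the space of the infinite sequences of steps (by the Ionescu-Tulcea theorem). -/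
noncomputable def interactionLaw {K : ℕ} (π : Policy K) (v : Fin K → ℝ) :
    Measure (ℕ → Step K) :=
  Kernel.trajMeasure (X := fun _ => Step K) (stepKernel π v 0 Fin.elim0)
    fun n => (stepKernel π v (n + 1)).comap (toHistory n) (measurable_toHistory n)

instance {K : ℕ} (π : Policy K) (v : Fin K → ℝ) : IsProbabilityMeasure (interactionLaw π v) := by
  unfold interactionLaw; infer_instance

/-- The estimate `x̂_t`, formed after `t` rounds. -/
def estimate {K : ℕ} (t : ℕ) (ω : ℕ → Step K) : Fin (K - 1) := (ω t).1

/-- `T_i(t)`: the number of plays of action `i` in the rounds `1, …, t`. -/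
def plays {K : ℕ} (i : Fin K) (t : ℕ) (ω : ℕ → Step K) : ℕ :=
  ((Finset.range t).filter fun s => (ω s).2.1 = i).card

/-- `μ̂_i(t)`: the empirical mean of the rewards of action `i` in the rounds `1, …, t`
(`0` if there are none). -/
noncomputable def empMean {K : ℕ} (i : Fin K) (t : ℕ) (ω : ℕ → Step K) : ℝ :=
  (∑ s ∈ (Finset.range t).filter fun s => (ω s).2.1 = i, (ω s).2.2) / (plays i t ω : ℝ)

/-- The statistic `Z(t) = T_x(t) T_{x+1}(t) / (2 (T_x(t) + T_{x+1}(t))) * |μ̂_x(t) - μ̂_{x+1}(t)|²`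
at `x = x̂_t`. It is `0` if one of the two arms has not been played. -/
noncomputable def statZ {K : ℕ} (t : ℕ) (ω : ℕ → Step K) : ℝ :=
  ((plays (leftArm (estimate t ω)) t ω : ℝ) * (plays (rightArm (estimate t ω)) t ω : ℝ)) /
      (2 * ((plays (leftArm (estimate t ω)) t ω : ℝ) + (plays (rightArm (estimate t ω)) t ω : ℝ))) *
    |empMean (leftArm (estimate t ω)) t ω - empMean (rightArm (estimate t ω)) t ω| ^ 2

/-- The constant `γ = 2 e³ 9⁶ / log 3`. -/
noncomputable def gammaConst : ℝ := 2 * Real.exp 3 * 9 ^ 6 / Real.log 3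

/-- The threshold `β(t,δ) = log(tγ(K-1)/δ) + 8 log log(tγ(K-1)/δ)`. -/
noncomputable def threshold (K : ℕ) (t : ℕ) (δ : ℝ) : ℝ :=
  Real.log ((t : ℝ) * gammaConst * ((K : ℝ) - 1) / δ) +
    8 * Real.log (Real.log ((t : ℝ) * gammaConst * ((K : ℝ) - 1) / δ))

/-- The stopping time `τ_δ`: the first round `t ≥ 1` with `Z(t) ≥ β(t,δ)`, and `⊤` if there is
none. -/
noncomputable def stopTime {K : ℕ} (δ : ℝ) (ω : ℕ → Step K) : ℕ∞ :=
  sInf {n : ℕ∞ | ∃ t : ℕ, n = (t : ℕ∞) ∧ 1 ≤ t ∧ threshold K t δ ≤ statZ t ω}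

end ChangePointBandit

open MeasureTheory ProbabilityTheory
open scoped ENNReal

namespace ChangePointBandit

/-! An error at time `t` means that the two arms next to the estimate have the same mean. That mean
cancels in the statistic, which is then at most `S²/(2A) + T²/(2B)`, where `S`, `T` are the noise
sums of the two arms and `A`, `B` their play counts (`pair_statistic_le`).

For a fixed precision `ρ`, the likelihood ratio of each arm's noise, mixed over a Gaussian drift,
integrates over one more reward of that arm to its previous value (`lintegral_gaussMix`). So the
product over two distinct arms is a nonnegative martingale started at 1, whatever the policy does
(`lintegral_pairMix_le`), and by Ville's inequality (`ville`) it ever reaches `c` with probability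
at most `1/c`.

The suitable precision is `1/k` with `k = ⌊log(tγ(K-1)/δ)⌋`. It depends on `t`, so a union over all
`k ≥ 1` is taken at levels `(K-1)k(k+1)/δ`. The threshold is large enough to force the mixture above
its level (`le_gaussMix_mul_gaussMix`): the `log log` term and `γ` pay for `k(k+1)`, for the
prefactors and for replacing `A` by `A + 1/k`. Since `∑ 1/(k(k+1)) = 1` and there are `K-1`
candidates, the total error is at most `δ`. -/

/-! ### One-step disintegration of the interaction law -/

/-- The history of the first `t` rounds of an infinite interaction. -/
def pastSteps {K : ℕ} (t : ℕ) (ω : ℕ → Step K) : History K t := fun i => ω i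

theorem measurable_pastSteps {K : ℕ} (t : ℕ) : Measurable (pastSteps (K := K) t) :=
  measurable_pi_lambda _ fun _ => measurable_pi_apply _

theorem pastSteps_succ {K : ℕ} (t : ℕ) (ω : ℕ → Step K) :
    pastSteps (t + 1) ω = Fin.snoc (pastSteps t ω) (ω t) := by
  funext i
  refine Fin.lastCases ?_ (fun j => ?_) i
  · simp [pastSteps]
  · simp [pastSteps]

theorem measurable_snoc {K t : ℕ} :
    Measurable fun p : History K t × Step K => (Fin.snoc p.1 p.2 : History K (t + 1)) := by
  refine measurable_pi_lambda _ fun i => ?_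
  refine Fin.lastCases ?_ (fun j => ?_) i
  · simpa using measurable_snd
  · simp only [Fin.snoc_castSucc]
    exact (measurable_pi_apply j).comp measurable_fst

theorem lintegral_first_step {K : ℕ} (π : Policy K) (v : Fin K → ℝ) {g : Step K → ℝ≥0∞}
    (hg : Measurable g) :
    ∫⁻ ω, g (ω 0) ∂interactionLaw π v = ∫⁻ s, g s ∂stepKernel π v 0 Fin.elim0 := by
  have h : (interactionLaw π v).map (Preorder.frestrictLe 0) =
      (stepKernel π v 0 Fin.elim0).map
        (MeasurableEquiv.piUnique (fun _ : Finset.Iic 0 => Step K)).symm := by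
    rw [interactionLaw, Kernel.trajMeasure, Measure.map_comp _ _ (by fun_prop),
      Kernel.traj_map_frestrictLe, Kernel.partialTraj_self, Measure.id_comp]
  have h0 : Measurable fun z : (Finset.Iic 0 → Step K) => g (z ⟨0, by simp⟩) :=
    hg.comp (measurable_pi_apply _)
  have h1 := lintegral_map (μ := interactionLaw π v) h0
    (Preorder.measurable_frestrictLe (X := fun _ : ℕ => Step K) 0)
  have h2 := lintegral_map (μ := stepKernel π v 0 Fin.elim0) h0
    (MeasurableEquiv.piUnique (fun _ : Finset.Iic 0 => Step K)).symm.measurable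
  rw [← h] at h2
  exact h1.symm.trans h2

/-- The conditional law of a step given the past is `stepKernel`. -/
theorem lintegral_step {K : ℕ} (π : Policy K) (v : Fin K → ℝ) (t : ℕ)
    {g : History K t × Step K → ℝ≥0∞} (hg : Measurable g) :
    ∫⁻ ω, g (pastSteps t ω, ω t) ∂interactionLaw π v =
      ∫⁻ ω, ∫⁻ s, g (pastSteps t ω, s) ∂stepKernel π v t (pastSteps t ω)
        ∂interactionLaw π v := by
  cases t with
  | zero =>
    have h : ∀ ω : ℕ → Step K, pastSteps 0 ω = Fin.elim0 := fun ω => Subsingleton.elim _ _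
    simp only [h, lintegral_const, measure_univ, mul_one]
    exact lintegral_first_step π v (hg.comp measurable_prodMk_left)
  | succ n =>
    have key := Kernel.map_frestrictLe_trajMeasure_compProd_eq_map_trajMeasure
      (X := fun _ => Step K) (μ₀ := stepKernel π v 0 Fin.elim0)
      (κ := fun n => (stepKernel π v (n + 1)).comap (toHistory n) (measurable_toHistory n))
      (a := n)
    change (interactionLaw π v).map _ ⊗ₘ _ = (interactionLaw π v).map _ at key
    let g' : (Finset.Iic n → Step K) × Step K → ℝ≥0∞ := fun p => g (toHistory n p.1, p.2)
    have hg' : Measurable g' :=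
      hg.comp (((measurable_toHistory n).comp measurable_fst).prodMk measurable_snd)
    have h1 : ∫⁻ p, g' p ∂(_ ⊗ₘ _) = ∫⁻ p, g' p ∂(interactionLaw π v).map _ :=
      congrArg (fun μ => ∫⁻ p, g' p ∂μ) key
    rw [Measure.lintegral_compProd hg', lintegral_map hg'.lintegral_kernel_prod_right'
      (by fun_prop), lintegral_map hg' (by fun_prop)] at h1
    exact h1.symm

/-! ### Ville's inequality -/

/-- Histories along which the process `M` has stayed below `c`. -/
def belowLevel {K : ℕ} (M : (t : ℕ) → History K t → ℝ≥0∞) (c : ℝ≥0∞) (n : ℕ) :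
    Set (History K n) :=
  {h | ∀ t : Fin (n + 1), M t (fun i => h (Fin.castLE (Nat.lt_succ_iff.1 t.2) i)) < c}

theorem measurableSet_belowLevel {K : ℕ} {M : (t : ℕ) → History K t → ℝ≥0∞}
    (hM : ∀ t, Measurable (M t)) (c : ℝ≥0∞) (n : ℕ) : MeasurableSet (belowLevel M c n) := by
  refine measurableSet_setOfPred.2 ?_
  refine Measurable.forall fun t => ?_
  refine measurableSet_setOfPred.1 (measurableSet_lt ((hM t).comp ?_) measurable_const)
  exact measurable_pi_lambda _ fun _ => measurable_pi_apply _

theorem pastSteps_mem_belowLevel {K : ℕ} {M : (t : ℕ) → History K t → ℝ≥0∞} {c : ℝ≥0∞} {n : ℕ}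
    {ω : ℕ → Step K} :
    pastSteps n ω ∈ belowLevel M c n ↔ ∀ t ≤ n, M t (pastSteps t ω) < c :=
  ⟨fun h t ht => h ⟨t, Nat.lt_succ_iff.2 ht⟩, fun h t => h t (Nat.lt_succ_iff.1 t.2)⟩

/-- Ville's inequality with a finite horizon, in the form that goes through by induction. -/
theorem ville_aux {K : ℕ} (π : Policy K) (v : Fin K → ℝ) {M : (t : ℕ) → History K t → ℝ≥0∞}
    (hM : ∀ t, Measurable (M t))
    (hstep : ∀ t h, ∫⁻ s, M (t + 1) (Fin.snoc h s) ∂stepKernel π v t h ≤ M t h)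
    (c : ℝ≥0∞) (n : ℕ) :
    c * interactionLaw π v (pastSteps n ⁻¹' belowLevel M c n)ᶜ +
      ∫⁻ ω in pastSteps n ⁻¹' belowLevel M c n, M n (pastSteps n ω) ∂interactionLaw π v ≤
        M 0 Fin.elim0 := by
  have hms : ∀ n, MeasurableSet (pastSteps n ⁻¹' belowLevel M c n) := fun n =>
    measurable_pastSteps n (measurableSet_belowLevel hM c n)
  induction n with
  | zero =>
    have h : ∀ ω : ℕ → Step K, pastSteps 0 ω = Fin.elim0 := fun ω => Subsingleton.elim _ _
    simp only [h]
    by_cases hc : M 0 Fin.elim0 < c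
    · have : pastSteps 0 ⁻¹' belowLevel M c 0 = Set.univ := by
        ext ω
        rw [Set.mem_preimage, pastSteps_mem_belowLevel]
        simp [h, hc]
      simp [this]
    · have : pastSteps 0 ⁻¹' belowLevel M c 0 = ∅ := by
        ext ω
        rw [Set.mem_preimage, pastSteps_mem_belowLevel]
        simp [h, not_lt.1 hc]
      simpa [this] using not_lt.1 hc
  | succ n ih =>
    refine le_trans ?_ ih
    set P := interactionLaw π v
    set B : ℕ → Set (ℕ → Step K) := fun n => pastSteps n ⁻¹' belowLevel M c n
    have hMm : Measurable fun ω : ℕ → Step K => M (n + 1) (pastSteps (n + 1) ω) :=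
      (hM _).comp (measurable_pastSteps _)
    have hsub : B (n + 1) ⊆ B n := fun ω hω =>
      pastSteps_mem_belowLevel.2 fun t ht => pastSteps_mem_belowLevel.1 hω t (by omega)
    -- These paths first reach `c` at time `n + 1`. Their mass moves from the integral to the term
    -- `c * P`, as in Markov's inequality.
    have hD : ∀ ω ∈ B n \ B (n + 1), c ≤ M (n + 1) (pastSteps (n + 1) ω) := by
      rintro ω ⟨h1, h2⟩
      by_contra hlt
      refine h2 (pastSteps_mem_belowLevel.2 fun t ht => ?_)
      rcases Nat.lt_or_ge n t with h | h
      · obtain rfl : t = n + 1 := by omega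
        exact not_le.1 hlt
      · exact pastSteps_mem_belowLevel.1 h1 t h
    have hcompl : P (B (n + 1))ᶜ ≤ P (B n)ᶜ + P (B n \ B (n + 1)) := by
      refine le_trans (measure_mono ?_) (measure_union_le _ _)
      intro ω hω
      by_cases h : ω ∈ B n
      · exact Or.inr ⟨h, hω⟩
      · exact Or.inl h
    have hcD : c * P (B n \ B (n + 1)) ≤
        ∫⁻ ω in B n \ B (n + 1), M (n + 1) (pastSteps (n + 1) ω) ∂P := by
      rw [← setLIntegral_const]
      exact setLIntegral_mono hMm hD
    have hsplit : ∫⁻ ω in B (n + 1), M (n + 1) (pastSteps (n + 1) ω) ∂P +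
        ∫⁻ ω in B n \ B (n + 1), M (n + 1) (pastSteps (n + 1) ω) ∂P =
          ∫⁻ ω in B n, M (n + 1) (pastSteps (n + 1) ω) ∂P := by
      have := lintegral_inter_add_sdiff (μ := P)
        (fun ω => M (n + 1) (pastSteps (n + 1) ω)) (B n) (hms (n + 1))
      rwa [Set.inter_eq_right.2 hsub] at this
    have hone : ∫⁻ ω in B n, M (n + 1) (pastSteps (n + 1) ω) ∂P ≤
        ∫⁻ ω in B n, M n (pastSteps n ω) ∂P := by
      rw [← lintegral_indicator (hms n), ← lintegral_indicator (hms n)]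
      -- `B n` depends only on the past, so its indicator passes through the conditional integral
      -- over step `n`.
      let g : History K n × Step K → ℝ≥0∞ := fun p =>
        (belowLevel M c n).indicator 1 p.1 * M (n + 1) (Fin.snoc p.1 p.2)
      have hg : Measurable g :=
        ((measurable_one.indicator (measurableSet_belowLevel hM c n)).comp measurable_fst).mul
          ((hM _).comp measurable_snoc)
      have h1 : ∀ ω, (B n).indicator (fun ω => M (n + 1) (pastSteps (n + 1) ω)) ω =
          g (pastSteps n ω, ω n) := by
        intro ω
        by_cases h : pastSteps n ω ∈ belowLevel M c n
        · rw [Set.indicator_of_mem (show ω ∈ B n from h)]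
          simp [g, h, pastSteps_succ]
        · rw [Set.indicator_of_notMem (show ω ∉ B n from h)]
          simp [g, h]
      rw [lintegral_congr h1, lintegral_step π v n hg]
      refine lintegral_mono fun ω => ?_
      by_cases h : pastSteps n ω ∈ belowLevel M c n
      · rw [Set.indicator_of_mem (show ω ∈ B n from h)]
        simpa [g, h] using hstep n (pastSteps n ω)
      · simp [g, h]
    calc c * P (B (n + 1))ᶜ + ∫⁻ ω in B (n + 1), M (n + 1) (pastSteps (n + 1) ω) ∂P
        ≤ c * (P (B n)ᶜ + P (B n \ B (n + 1))) +
          ∫⁻ ω in B (n + 1), M (n + 1) (pastSteps (n + 1) ω) ∂P := by gcongr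
      _ ≤ c * P (B n)ᶜ + (∫⁻ ω in B (n + 1), M (n + 1) (pastSteps (n + 1) ω) ∂P +
          ∫⁻ ω in B n \ B (n + 1), M (n + 1) (pastSteps (n + 1) ω) ∂P) := by
        rw [mul_add, add_assoc, add_comm (c * P (B n \ B (n + 1)))]
        gcongr
      _ ≤ c * P (B n)ᶜ + ∫⁻ ω in B n, M n (pastSteps n ω) ∂P := by
        rw [hsplit]
        gcongr

/-- **Ville's inequality** for nonnegative supermartingales of the interaction. -/
theorem ville {K : ℕ} (π : Policy K) (v : Fin K → ℝ) {M : (t : ℕ) → History K t → ℝ≥0∞}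
    (hM : ∀ t, Measurable (M t))
    (hstep : ∀ t h, ∫⁻ s, M (t + 1) (Fin.snoc h s) ∂stepKernel π v t h ≤ M t h)
    (c : ℝ≥0∞) :
    c * interactionLaw π v {ω | ∃ t, c ≤ M t (pastSteps t ω)} ≤ M 0 Fin.elim0 := by
  have hU : {ω : ℕ → Step K | ∃ t, c ≤ M t (pastSteps t ω)} =
      ⋃ n, (pastSteps n ⁻¹' belowLevel M c n)ᶜ := by
    ext ω
    simp only [Set.mem_ofPred_eq, Set.mem_iUnion, Set.mem_compl_iff, Set.mem_preimage,
      pastSteps_mem_belowLevel, not_forall, not_lt]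
    exact ⟨fun ⟨t, h⟩ => ⟨t, t, le_rfl, h⟩, fun ⟨_, t, _, h⟩ => ⟨t, h⟩⟩
  have hmono : Monotone fun n => (pastSteps n ⁻¹' belowLevel M c n : Set (ℕ → Step K))ᶜ := by
    refine monotone_nat_of_le_succ fun n => Set.compl_subset_compl.2 fun ω hω => ?_
    exact pastSteps_mem_belowLevel.2 fun t ht => pastSteps_mem_belowLevel.1 hω t (by omega)
  rw [hU, hmono.measure_iUnion, ENNReal.mul_iSup]
  exact iSup_le fun n => le_self_add.trans (ville_aux π v hM hstep c n)

/-! ### Gaussian mixtures and the two-arm martingale -/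

/-- The likelihood ratio of `n` standard Gaussian noise terms with sum `s`, averaged over a
Gaussian drift of precision `ρ`. -/
noncomputable def gaussMix (ρ n s : ℝ) : ℝ≥0∞ :=
  ENNReal.ofReal (√(ρ / (n + ρ)) * Real.exp (s ^ 2 / (2 * (n + ρ))))

theorem measurable_gaussMix (ρ : ℝ) : Measurable fun p : ℝ × ℝ => gaussMix ρ p.1 p.2 := by
  unfold gaussMix
  fun_prop

theorem gaussMix_zero {ρ : ℝ} (hρ : 0 < ρ) : gaussMix ρ 0 0 = 1 := by
  simp [gaussMix, hρ.ne']

/-- Completing the square in `y` turns the integrand times the reward density into `gaussMix ρ n s`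
times the Gaussian density of mean `m + s/(n+ρ)` and variance `(n+1+ρ)/(n+ρ)`, the predictive law
under the mixture. -/
theorem lintegral_gaussMix {ρ n : ℝ} (hρ : 0 < ρ) (hn : 0 ≤ n) (s m : ℝ) :
    ∫⁻ y, gaussMix ρ (n + 1) (s + (y - m)) ∂gaussianReal m 1 = gaussMix ρ n s := by
  have ha : 0 < n + ρ := by linarith
  have ha1 : 0 < n + 1 + ρ := by linarith
  obtain ⟨w, hw⟩ : ∃ w : NNReal, (w : ℝ) = (n + 1 + ρ) / (n + ρ) :=
    ⟨⟨_, (div_pos ha1 ha).le⟩, rfl⟩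
  have hw0 : w ≠ 0 := by
    intro h
    rw [h] at hw
    exact (div_pos ha1 ha).ne hw
  have hmeas : Measurable fun y : ℝ => gaussMix ρ (n + 1) (s + (y - m)) :=
    (measurable_gaussMix ρ).comp (by fun_prop : Measurable fun y : ℝ => (n + 1, s + (y - m)))
  rw [gaussianReal_of_var_ne_zero _ one_ne_zero,
    lintegral_withDensity_eq_lintegral_mul _ (measurable_gaussianPDF _ _) hmeas]
  have hpt : ∀ y, (gaussianPDF m 1 * fun y => gaussMix ρ (n + 1) (s + (y - m))) y =
      gaussMix ρ n s * gaussianPDF (m + s / (n + ρ)) w y := by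
    intro y
    simp only [Pi.mul_apply, gaussMix, gaussianPDF]
    rw [← ENNReal.ofReal_mul (gaussianPDFReal_nonneg _ _ _), ← ENNReal.ofReal_mul (by positivity)]
    congr 1
    simp only [gaussianPDFReal, hw, NNReal.coe_one, mul_one]
    have he : Real.exp (-(y - m) ^ 2 / 2) *
          Real.exp ((s + (y - m)) ^ 2 / (2 * (n + 1 + ρ))) =
        Real.exp (s ^ 2 / (2 * (n + ρ))) *
          Real.exp (-(y - (m + s / (n + ρ))) ^ 2 / (2 * ((n + 1 + ρ) / (n + ρ)))) := by
      rw [← Real.exp_add, ← Real.exp_add]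
      congr 1
      field_simp
      ring
    have hs : (√(2 * Real.pi))⁻¹ * √(ρ / (n + 1 + ρ)) =
        √(ρ / (n + ρ)) * (√(2 * Real.pi * ((n + 1 + ρ) / (n + ρ))))⁻¹ := by
      rw [← Real.sqrt_inv, ← Real.sqrt_inv, ← Real.sqrt_mul (by positivity),
        ← Real.sqrt_mul (by positivity)]
      congr 1
      field_simp
    linear_combination
      ((√(2 * Real.pi))⁻¹ * √(ρ / (n + 1 + ρ))) * he +
      (Real.exp (s ^ 2 / (2 * (n + ρ))) *
          Real.exp (-(y - (m + s / (n + ρ))) ^ 2 / (2 * ((n + 1 + ρ) / (n + ρ))))) * hs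
  simp only [hpt]
  rw [lintegral_const_mul _ (measurable_gaussianPDF _ _), lintegral_gaussianPDF_eq_one _ hw0,
    mul_one]

/-- The number of plays of arm `i` in a history. -/
noncomputable def histPlays {K t : ℕ} (i : Fin K) (h : History K t) : ℝ :=
  ∑ j, if (h j).2.1 = i then 1 else 0

/-- The sum of the noise terms of the plays of arm `i` in a history. -/
noncomputable def histNoise {K t : ℕ} (v : Fin K → ℝ) (i : Fin K) (h : History K t) : ℝ :=
  ∑ j, if (h j).2.1 = i then (h j).2.2 - v i else 0

theorem histPlays_nonneg {K t : ℕ} (i : Fin K) (h : History K t) : 0 ≤ histPlays i h :=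
  Finset.sum_nonneg fun _ _ => by split_ifs <;> norm_num

theorem measurableSet_arm_eq {K t : ℕ} (i : Fin K) (j : Fin t) :
    MeasurableSet {h : History K t | (h j).2.1 = i} :=
  ((measurable_fst.comp measurable_snd).comp (measurable_pi_apply j)) (measurableSet_singleton i)

theorem measurable_histPlays {K t : ℕ} (i : Fin K) :
    Measurable (histPlays i : History K t → ℝ) :=
  Finset.measurable_sum _ fun j _ =>
    Measurable.ite (measurableSet_arm_eq i j) measurable_const measurable_const

theorem measurable_histNoise {K t : ℕ} (v : Fin K → ℝ) (i : Fin K) :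
    Measurable (histNoise v i : History K t → ℝ) :=
  Finset.measurable_sum _ fun j _ =>
    Measurable.ite (measurableSet_arm_eq i j) (by fun_prop) measurable_const

theorem histPlays_snoc {K t : ℕ} (i : Fin K) (h : History K t) (s : Step K) :
    histPlays i (Fin.snoc h s : History K (t + 1)) =
      histPlays i h + if s.2.1 = i then 1 else 0 := by
  rw [histPlays, Fin.sum_univ_castSucc]
  simp only [Fin.snoc_castSucc, Fin.snoc_last, histPlays]

theorem histNoise_snoc {K t : ℕ} (v : Fin K → ℝ) (i : Fin K) (h : History K t) (s : Step K) :
    histNoise v i (Fin.snoc h s : History K (t + 1)) =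
      histNoise v i h + if s.2.1 = i then s.2.2 - v i else 0 := by
  rw [histNoise, Fin.sum_univ_castSucc]
  simp only [Fin.snoc_castSucc, Fin.snoc_last, histNoise]

/-- The product of the Gaussian mixtures of the two arms `l` and `r`. -/
noncomputable def pairMix {K : ℕ} (v : Fin K → ℝ) (l r : Fin K) (ρ : ℝ) (t : ℕ)
    (h : History K t) : ℝ≥0∞ :=
  gaussMix ρ (histPlays l h) (histNoise v l h) * gaussMix ρ (histPlays r h) (histNoise v r h)

theorem measurable_pairMix {K : ℕ} (v : Fin K → ℝ) (l r : Fin K) (ρ : ℝ) (t : ℕ) :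
    Measurable (pairMix v l r ρ t) :=
  ((measurable_gaussMix ρ).comp ((measurable_histPlays l).prodMk (measurable_histNoise v l))).mul
    ((measurable_gaussMix ρ).comp ((measurable_histPlays r).prodMk (measurable_histNoise v r)))

theorem pairMix_zero {K : ℕ} (v : Fin K → ℝ) (l r : Fin K) {ρ : ℝ} (hρ : 0 < ρ)
    (h : History K 0) : pairMix v l r ρ 0 h = 1 := by
  simp [pairMix, histPlays, histNoise, gaussMix_zero hρ]

theorem lintegral_stepKernel {K : ℕ} (π : Policy K) (v : Fin K → ℝ) (t : ℕ) (h : History K t)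
    {g : Step K → ℝ≥0∞} (hg : Measurable g) :
    ∫⁻ s, g s ∂stepKernel π v t h =
      ∫⁻ x, ∫⁻ a, ∫⁻ y, g (x, a, y) ∂gaussianReal (v a) 1 ∂π.sample t (h, x)
        ∂π.recommend t h := by
  rw [stepKernel, Kernel.lintegral_compProd _ _ _ hg]
  refine lintegral_congr fun x => ?_
  exact Kernel.lintegral_compProd _ _ _ (hg.comp measurable_prodMk_left)

/-- Since `l ≠ r`, a step changes at most one factor, and integrating its reward restores that
factor. This holds for every action, so the laws of the estimate and of the action play no role. -/
theorem lintegral_pairMix_le {K : ℕ} (π : Policy K) (v : Fin K → ℝ) {l r : Fin K} (hlr : l ≠ r)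
    {ρ : ℝ} (hρ : 0 < ρ) (t : ℕ) (h : History K t) :
    ∫⁻ s, pairMix v l r ρ (t + 1) (Fin.snoc h s) ∂stepKernel π v t h ≤ pairMix v l r ρ t h := by
  have hsnoc : Measurable fun s : Step K => (Fin.snoc h s : History K (t + 1)) :=
    measurable_snoc.comp measurable_prodMk_left
  have hM : Measurable fun s : Step K => pairMix v l r ρ (t + 1) (Fin.snoc h s) :=
    (measurable_pairMix v l r ρ (t + 1)).comp hsnoc
  rw [lintegral_stepKernel π v t h hM]
  have key : ∀ (x : Fin (K - 1)) (a : Fin K),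
      ∫⁻ y, pairMix v l r ρ (t + 1) (Fin.snoc h (x, a, y)) ∂gaussianReal (v a) 1 =
        pairMix v l r ρ t h := by
    intro x a
    have hmeas : ∀ i, Measurable fun y : ℝ =>
        gaussMix ρ (histPlays i h + 1) (histNoise v i h + (y - v i)) := fun i =>
      (measurable_gaussMix ρ).comp
        (by fun_prop : Measurable fun y : ℝ => (histPlays i h + 1, histNoise v i h + (y - v i)))
    simp only [pairMix, histPlays_snoc, histNoise_snoc]
    by_cases hl : a = l
    · subst hl
      simp only [if_true, if_neg hlr, add_zero]
      rw [lintegral_mul_const _ (hmeas a), lintegral_gaussMix hρ (histPlays_nonneg a h)]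
    · by_cases hr : a = r
      · subst hr
        simp only [if_true, if_neg hl, add_zero]
        rw [lintegral_const_mul _ (hmeas a), lintegral_gaussMix hρ (histPlays_nonneg a h)]
      · simp [hl, hr]
  simp [key]

/-! ### Deterministic comparison of the threshold with the mixture -/

/-- The gap between the two sides is exactly `(S + T)²/(2(A + B))`. -/
theorem pair_statistic_le {A B : ℝ} (hA : 0 < A) (hB : 0 < B) (S T m : ℝ) :
    A * B / (2 * (A + B)) * |(S + A * m) / A - (T + B * m) / B| ^ 2 ≤
      S ^ 2 / (2 * A) + T ^ 2 / (2 * B) := by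
  have h : S ^ 2 / (2 * A) + T ^ 2 / (2 * B) -
      A * B / (2 * (A + B)) * |(S + A * m) / A - (T + B * m) / B| ^ 2 =
        (S + T) ^ 2 / (2 * (A + B)) := by
    rw [sq_abs]
    field_simp
    ring
  have h2 : 0 ≤ (S + T) ^ 2 / (2 * (A + B)) := by positivity
  linarith

/-- The factor `e⁹` absorbs the loss in the exponent and the 2 absorbs `k + 1 ≤ 2k`, both in
`le_gaussMix_mul_gaussMix`. -/
theorem two_mul_exp_nine_le_gammaConst : 2 * Real.exp 9 ≤ gammaConst := by
  have hlog : Real.log 3 ≤ 2 := (Real.log_le_sub_one_of_pos (by norm_num)).trans (by norm_num)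
  have hlog0 : 0 < Real.log 3 := Real.log_pos (by norm_num)
  have he : Real.exp 6 ≤ 3 ^ 6 := by
    rw [show (6 : ℝ) = (6 : ℕ) * 1 by norm_num, Real.exp_nat_mul]
    gcongr
    exact Real.exp_one_lt_three.le
  rw [gammaConst, le_div_iff₀ hlog0, show (9 : ℝ) = 3 + 6 by norm_num, Real.exp_add]
  have h1 : Real.exp 6 * Real.log 3 ≤ (3 + 6) ^ 6 :=
    (mul_le_mul he hlog hlog0.le (by norm_num)).trans (by norm_num)
  nlinarith [mul_le_mul_of_nonneg_left h1 (Real.exp_pos 3).le]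

/-- The argument of the logarithms in the threshold. -/
noncomputable def thresholdArg (K t : ℕ) (δ : ℝ) : ℝ := (t : ℝ) * gammaConst * ((K : ℝ) - 1) / δ

theorem one_le_log_thresholdArg {K t : ℕ} {δ : ℝ} (hK : 2 ≤ K) (ht : 1 ≤ t) (hδ0 : 0 < δ)
    (hδ1 : δ < 1) : 1 ≤ Real.log (thresholdArg K t δ) := by
  have hγ := two_mul_exp_nine_le_gammaConst
  have hK' : (1 : ℝ) ≤ (K : ℝ) - 1 := by
    have : (2 : ℝ) ≤ K := by exact_mod_cast hK
    linarith
  have ht' : (1 : ℝ) ≤ t := by exact_mod_cast ht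
  have h9 : Real.exp 1 ≤ Real.exp 9 := Real.exp_le_exp.2 (by norm_num)
  have hγ1 : Real.exp 1 ≤ gammaConst := by linarith [Real.exp_pos 9]
  have hγ0 : 0 ≤ gammaConst := (Real.exp_pos 1).le.trans hγ1
  have h1 : gammaConst ≤ thresholdArg K t δ := by
    rw [thresholdArg, le_div_iff₀ hδ0]
    calc gammaConst * δ ≤ gammaConst * 1 := by gcongr
      _ = 1 * gammaConst * 1 := by ring
      _ ≤ t * gammaConst * ((K : ℝ) - 1) := by gcongr
  rw [Real.le_log_iff_exp_le ((Real.exp_pos 1).trans_le (hγ1.trans h1))]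
  exact hγ1.trans h1

/-- If the statistic crosses the threshold, the Gaussian mixture of precision `1 / k` is large,
where `k` is the integer part of the logarithm in the threshold. -/
theorem le_gaussMix_mul_gaussMix {K t : ℕ} {δ : ℝ} (hK : 2 ≤ K) (hδ0 : 0 < δ) (hδ1 : δ < 1)
    {A B S T : ℝ} (hA : 1 ≤ A) (hB : 1 ≤ B) (hAB : A + B ≤ t)
    (h : threshold K t δ ≤ S ^ 2 / (2 * A) + T ^ 2 / (2 * B)) {k : ℕ}
    (hk : k = ⌊Real.log (thresholdArg K t δ)⌋₊) :
    ENNReal.ofReal (((K : ℝ) - 1) * (k * (k + 1)) / δ) ≤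
      gaussMix (1 / k) A S * gaussMix (1 / k) B T := by
  have ht2 : (2 : ℝ) ≤ t := by linarith
  have ht1 : 1 ≤ t := by
    have : (1 : ℝ) ≤ t := by linarith
    exact_mod_cast this
  have hL1 := one_le_log_thresholdArg hK ht1 hδ0 hδ1
  have hC : (0 : ℝ) < (K : ℝ) - 1 := by
    have : (2 : ℝ) ≤ K := by exact_mod_cast hK
    linarith
  have hγ := two_mul_exp_nine_le_gammaConst
  have hγ0 : 0 < gammaConst := lt_of_lt_of_le (by positivity) hγ
  have harg : 0 < thresholdArg K t δ := by unfold thresholdArg; positivity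
  change Real.log (thresholdArg K t δ) + 8 * Real.log (Real.log (thresholdArg K t δ)) ≤ _ at h
  have hexp := Real.exp_log harg
  set L := Real.log (thresholdArg K t δ) with hL
  have hkL : (k : ℝ) ≤ L := hk ▸ Nat.floor_le (by linarith)
  have hLk : L ≤ k + 1 := hk ▸ (Nat.lt_floor_add_one L).le
  have hk1 : (1 : ℝ) ≤ k := by
    have : 1 ≤ k := hk ▸ Nat.le_floor (by simpa using hL1)
    exact_mod_cast this
  have hk0 : (0 : ℝ) < k := by linarith
  have hlogL : Real.log L ≤ L := (Real.log_le_sub_one_of_pos (by linarith)).trans (by linarith)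
  have hmono : ∀ a : ℝ, 1 ≤ a → ∀ s : ℝ,
      s ^ 2 / (2 * a) * (k / (k + 1)) ≤ s ^ 2 / (2 * (a + 1 / k)) := by
    intro a ha s
    rw [div_mul_div_comm, div_le_div_iff₀ (by positivity) (by positivity)]
    have : (k : ℝ) * (2 * (a + 1 / k)) ≤ 2 * a * (k + 1) := by
      have : (k : ℝ) * (1 / k) = 1 := by field_simp
      nlinarith
    nlinarith [mul_le_mul_of_nonneg_left this (sq_nonneg s)]
  -- The hypothesis `a + 1 ≤ t` will hold because the other arm has been played at least once; it
  -- leaves room for `1/k ≤ 1`.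
  have hroot : ∀ a : ℝ, 1 ≤ a → a + 1 ≤ t → √(1 / (k * t)) ≤ √(1 / k / (a + 1 / k)) := by
    intro a ha hat
    apply Real.sqrt_le_sqrt
    rw [div_div]
    have : (1 : ℝ) / k ≤ 1 := by rw [div_le_one hk0]; exact hk1
    gcongr
    linarith
  -- The factor `k/(k+1)` costs `(L + 8 log L)/(k+1)`, which is at most 9 because `log L ≤ L ≤ k +
  -- 1`.
  have hE : L + 8 * Real.log L - 9 ≤ S ^ 2 / (2 * (A + 1 / k)) + T ^ 2 / (2 * (B + 1 / k)) := by
    refine le_trans ?_ (add_le_add (hmono A hA S) (hmono B hB T))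
    rw [← add_mul]
    refine le_trans ?_ (mul_le_mul_of_nonneg_right h (by positivity))
    rw [mul_div_assoc', le_div_iff₀ (by positivity)]
    nlinarith
  rw [gaussMix, gaussMix, ← ENNReal.ofReal_mul (by positivity)]
  refine ENNReal.ofReal_le_ofReal ?_
  calc ((K : ℝ) - 1) * (k * (k + 1)) / δ
      ≤ 1 / (k * t) * Real.exp (L + 8 * Real.log L - 9) := by
        have h8 : Real.exp (8 * Real.log L) = L ^ 8 := by
          rw [show (8 : ℝ) = (8 : ℕ) by norm_num, Real.exp_nat_mul, Real.exp_log (by linarith)]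
        rw [Real.exp_sub, Real.exp_add, hexp, h8, thresholdArg]
        have hpoly : (k : ℝ) ^ 2 * (k + 1) ≤ 2 * L ^ 8 := by
          have h3 : (k : ℝ) ^ 3 ≤ k ^ 8 := pow_le_pow_right₀ hk1 (by norm_num)
          have h4 : (k : ℝ) ^ 8 ≤ L ^ 8 := by gcongr
          nlinarith
        have hfin : (k : ℝ) ^ 2 * (k + 1) * Real.exp 9 ≤ gammaConst * L ^ 8 := by
          calc (k : ℝ) ^ 2 * (k + 1) * Real.exp 9 ≤ 2 * L ^ 8 * Real.exp 9 := by gcongr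
            _ = 2 * Real.exp 9 * L ^ 8 := by ring
            _ ≤ gammaConst * L ^ 8 := by gcongr
        have hid : 1 / (k * (t : ℝ)) *
            ((t : ℝ) * gammaConst * ((K : ℝ) - 1) / δ * L ^ 8 / Real.exp 9) =
              ((K : ℝ) - 1) * (gammaConst * L ^ 8 / (k * Real.exp 9)) / δ := by
          field_simp
        rw [hid]
        gcongr
        rw [le_div_iff₀ (by positivity)]
        linarith
    _ = √(1 / (k * t)) * √(1 / (k * t)) * Real.exp (L + 8 * Real.log L - 9) := by
        rw [Real.mul_self_sqrt (by positivity)]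
    _ ≤ √(1 / k / (A + 1 / k)) * √(1 / k / (B + 1 / k)) *
          Real.exp (S ^ 2 / (2 * (A + 1 / k)) + T ^ 2 / (2 * (B + 1 / k))) := by
        have h1 := hroot A hA (by linarith)
        have h2 := hroot B hB (by linarith)
        gcongr
    _ = _ := by
        rw [Real.exp_add]
        ring

/-! ### Plays and empirical means in terms of histories -/

theorem histPlays_pastSteps {K : ℕ} (i : Fin K) (t : ℕ) (ω : ℕ → Step K) :
    histPlays i (pastSteps t ω) = plays i t ω := by
  rw [histPlays, plays, Finset.card_filter, Nat.cast_sum,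
    ← Fin.sum_univ_eq_sum_range (fun s => (((if (ω s).2.1 = i then 1 else 0 : ℕ)) : ℝ)) t]
  refine Finset.sum_congr rfl fun j _ => ?_
  by_cases h : (ω j).2.1 = i <;> simp [pastSteps, h]

theorem empMean_eq {K : ℕ} (v : Fin K → ℝ) (i : Fin K) (t : ℕ) (ω : ℕ → Step K) :
    empMean i t ω =
      (histNoise v i (pastSteps t ω) + plays i t ω * v i) / plays i t ω := by
  have h : ∑ s ∈ (Finset.range t).filter fun s => (ω s).2.1 = i, (ω s).2.2 =
      histNoise v i (pastSteps t ω) + plays i t ω * v i := by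
    rw [← histPlays_pastSteps, histPlays, histNoise, Finset.sum_mul, ← Finset.sum_add_distrib,
      Finset.sum_filter,
      ← Fin.sum_univ_eq_sum_range (fun s => if (ω s).2.1 = i then (ω s).2.2 else 0) t]
    refine Finset.sum_congr rfl fun j _ => ?_
    by_cases h : (ω j).2.1 = i <;> simp [pastSteps, h]
  rw [empMean, h]

theorem plays_add_plays_le {K : ℕ} {l r : Fin K} (hlr : l ≠ r) (t : ℕ) (ω : ℕ → Step K) :
    plays l t ω + plays r t ω ≤ t := by
  rw [plays, plays, ← Finset.card_union_of_disjoint]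
  · refine (Finset.card_le_card (Finset.union_subset (Finset.filter_subset _ _)
      (Finset.filter_subset _ _))).trans (Finset.card_range t).le
  · exact Finset.disjoint_filter.2 fun s _ h1 h2 => hlr (h1.symm.trans h2)

theorem leftArm_ne_rightArm {K : ℕ} (x : Fin (K - 1)) : leftArm x ≠ rightArm x := by
  simp [leftArm, rightArm]

/-! ### Crossing events and the union bound -/

/-- The event that the Gaussian mixture of precision `1 / (j + 1)` of the two arms next to `x`
ever reaches its critical level. -/
def crossing {K : ℕ} (v : Fin K → ℝ) (δ : ℝ) (x : Fin (K - 1)) (j : ℕ) : Set (ℕ → Step K) :=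
  {ω | ∃ t, ENNReal.ofReal (((K : ℝ) - 1) * ((j + 1) * (j + 2)) / δ) ≤
    pairMix v (leftArm x) (rightArm x) (1 / (j + 1)) t (pastSteps t ω)}

theorem measure_crossing_le {K : ℕ} (hK : 2 ≤ K) {δ : ℝ} (hδ0 : 0 < δ) (π : Policy K)
    (v : Fin K → ℝ) (x : Fin (K - 1)) (j : ℕ) :
    interactionLaw π v (crossing v δ x j) ≤
      ENNReal.ofReal (δ / ((K : ℝ) - 1)) * ENNReal.ofReal (1 / ((j + 1) * (j + 2))) := by
  have hC : (0 : ℝ) < (K : ℝ) - 1 := by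
    have : (2 : ℝ) ≤ K := by exact_mod_cast hK
    linarith
  have hρ : (0 : ℝ) < 1 / (j + 1) := by positivity
  have hc : 0 < ((K : ℝ) - 1) * ((j + 1) * (j + 2)) / δ := by positivity
  have h := ville π v (fun t => measurable_pairMix v (leftArm x) (rightArm x) (1 / (j + 1)) t)
    (fun t h => lintegral_pairMix_le π v (leftArm_ne_rightArm x) hρ t h)
    (ENNReal.ofReal (((K : ℝ) - 1) * ((j + 1) * (j + 2)) / δ))
  rw [pairMix_zero _ _ _ hρ, mul_comm, ← ENNReal.le_div_iff_mul_le
    (Or.inl (ENNReal.ofReal_pos.2 hc).ne') (Or.inl ENNReal.ofReal_ne_top), one_div (ENNReal.ofReal _),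
    ← ENNReal.ofReal_inv_of_pos hc] at h
  refine h.trans_eq ?_
  rw [← ENNReal.ofReal_mul (by positivity)]
  congr 1
  field_simp

/-- The partial sums telescope to `1 - 1/(n+1)`. -/
theorem tsum_inv_mul_succ_le_one :
    ∑' j : ℕ, ENNReal.ofReal (1 / (((j : ℝ) + 1) * (j + 2))) ≤ 1 := by
  rw [ENNReal.tsum_eq_iSup_nat]
  refine iSup_le fun n => ?_
  have h : ∑ j ∈ Finset.range n, 1 / (((j : ℝ) + 1) * (j + 2)) = 1 - 1 / (n + 1) := by
    induction n with
    | zero => simp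
    | succ n ih =>
      rw [Finset.sum_range_succ, ih]
      push_cast
      field_simp
      ring
  rw [← ENNReal.ofReal_sum_of_nonneg fun _ _ => by positivity, h, ENNReal.ofReal_le_one]
  have : (0 : ℝ) ≤ 1 / (n + 1) := by positivity
  linarith

theorem mem_crossing_of_threshold_le_statZ {K : ℕ} (hK : 2 ≤ K) {δ : ℝ} (hδ0 : 0 < δ)
    (hδ1 : δ < 1) (v : Fin K → ℝ) {t : ℕ} (ht : 1 ≤ t) {ω : ℕ → Step K}
    (hZ : threshold K t δ ≤ statZ t ω) (hx : estimate t ω ∉ changePoints v) :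
    ∃ j, ω ∈ crossing v δ (estimate t ω) j := by
  rw [statZ] at hZ
  set x := estimate t ω
  have hm : v (rightArm x) = v (leftArm x) := by
    by_contra h
    exact hx (Finset.mem_filter.2 ⟨Finset.mem_univ _, fun h' => h h'.symm⟩)
  have hL1 := one_le_log_thresholdArg hK ht hδ0 hδ1
  -- An unplayed arm makes the statistic 0, so a positive threshold forces both arms to have been
  -- played.
  have hpos : 0 < threshold K t δ := by
    have h1 := Real.log_nonneg hL1
    change 0 < Real.log (thresholdArg K t δ) + 8 * Real.log (Real.log (thresholdArg K t δ))
    linarith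
  have hl : plays (leftArm x) t ω ≠ 0 := by
    intro h
    simp only [h, Nat.cast_zero, zero_mul, zero_div] at hZ
    linarith
  have hr : plays (rightArm x) t ω ≠ 0 := by
    intro h
    simp only [h, Nat.cast_zero, mul_zero, zero_mul, zero_div] at hZ
    linarith
  have hl1 : (1 : ℝ) ≤ plays (leftArm x) t ω := by exact_mod_cast Nat.one_le_iff_ne_zero.2 hl
  have hr1 : (1 : ℝ) ≤ plays (rightArm x) t ω := by exact_mod_cast Nat.one_le_iff_ne_zero.2 hr
  have hsum : (plays (leftArm x) t ω : ℝ) + plays (rightArm x) t ω ≤ t := by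
    exact_mod_cast plays_add_plays_le (leftArm_ne_rightArm x) t ω
  rw [empMean_eq v, empMean_eq v, hm] at hZ
  have hle := hZ.trans (pair_statistic_le (by linarith) (by linarith) _ _ _)
  obtain ⟨j, hj⟩ : ∃ j, ⌊Real.log (thresholdArg K t δ)⌋₊ = j + 1 :=
    Nat.exists_eq_succ_of_ne_zero (Nat.floor_pos.2 hL1).ne'
  have hmain := le_gaussMix_mul_gaussMix hK hδ0 hδ1 hl1 hr1 hsum hle hj.symm
  refine ⟨j, t, ?_⟩
  rw [pairMix, histPlays_pastSteps, histPlays_pastSteps]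
  push_cast at hmain
  rwa [add_assoc (j : ℝ) 1 1, one_add_one_eq_two] at hmain

theorem threshold_le_statZ_of_stopTime_eq {K : ℕ} {δ : ℝ} {ω : ℕ → Step K} {t : ℕ}
    (h : stopTime δ ω = (t : ℕ∞)) : 1 ≤ t ∧ threshold K t δ ≤ statZ t ω := by
  have hne : {n : ℕ∞ | ∃ t : ℕ, n = (t : ℕ∞) ∧ 1 ≤ t ∧ threshold K t δ ≤ statZ t ω}.Nonempty := by
    -- The infimum of the empty set is `⊤`, so a finite value is attained.
    by_contra hemp
    rw [stopTime, Set.not_nonempty_iff_eq_empty.1 hemp, sInf_empty] at h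
    exact ENat.natCast_ne_top t h.symm
  obtain ⟨s, hs, hs'⟩ := csInf_mem hne
  obtain rfl : t = s := by exact_mod_cast h.symm.trans hs
  exact hs'

end ChangePointBandit

theorem mainTheorem6 (K N : ℕ) (hN : 1 ≤ N) (δ : ℝ) (hδ0 : 0 < δ) (hδ1 : δ < 1)
    (v : Fin K → ℝ) (hv : v ∈ ChangePointBandit.Env K N) (π : ChangePointBandit.Policy K) :
    (ChangePointBandit.interactionLaw π v).real
      {ω | ∃ t : ℕ, ChangePointBandit.stopTime δ ω = (t : ℕ∞) ∧
        ChangePointBandit.estimate t ω ∉ ChangePointBandit.changePoints v} ≤ δ := by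
  open ChangePointBandit in
  have hK : 2 ≤ K := by
    obtain ⟨x, -⟩ := Finset.card_pos.1 (hv.1.symm ▸ hN : 0 < (changePoints v).card)
    have := x.2
    omega
  have hC : (0 : ℝ) < (K : ℝ) - 1 := by
    have : (2 : ℝ) ≤ K := by exact_mod_cast hK
    linarith
  refine ENNReal.toReal_le_of_le_ofReal hδ0.le ?_
  calc interactionLaw π v {ω | ∃ t : ℕ, stopTime δ ω = (t : ℕ∞) ∧ estimate t ω ∉ changePoints v}
      -- True change points may be included: each arm's noise is centred at its own mean, so the
      -- bound on crossings holds for every `x`.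
      ≤ interactionLaw π v (⋃ x, ⋃ j, crossing v δ x j) := by
        refine measure_mono ?_
        rintro ω ⟨t, ht, hx⟩
        obtain ⟨ht1, hZ⟩ := threshold_le_statZ_of_stopTime_eq ht
        obtain ⟨j, hj⟩ := mem_crossing_of_threshold_le_statZ hK hδ0 hδ1 v ht1 hZ hx
        exact Set.mem_iUnion₂.2 ⟨_, j, hj⟩
    _ ≤ ∑ x : Fin (K - 1), ∑' j, interactionLaw π v (crossing v δ x j) :=
        (measure_iUnion_fintype_le _ _).trans
          (Finset.sum_le_sum fun x _ => measure_iUnion_le _)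
    _ ≤ ∑ _x : Fin (K - 1), ENNReal.ofReal (δ / ((K : ℝ) - 1)) := by
        refine Finset.sum_le_sum fun x _ => ?_
        refine (ENNReal.tsum_le_tsum fun j => measure_crossing_le hK hδ0 π v x j).trans ?_
        rw [ENNReal.tsum_mul_left]
        exact (mul_le_mul_right tsum_inv_mul_succ_le_one _).trans_eq (mul_one _)
    _ = ENNReal.ofReal δ := by
        rw [Finset.sum_const, Finset.card_univ, Fintype.card_fin, nsmul_eq_mul,
          ← ENNReal.ofReal_natCast, ← ENNReal.ofReal_mul (by positivity),
          Nat.cast_sub (by omega), Nat.cast_one, mul_div_cancel₀ _ hC.ne']
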